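/- Words are finite sequences of letters from a totally ordered alphabet (for example the positive integers), compared lexicographically (a proper prefix is smaller); $\deg(w)$ records how often each letter occurs in $w$. A nonempty word is Lyndon if it is strictly smaller than all its non-trivial cyclic rearrangements. The Lyndon factorisation $w=u_1\cdot\ldots\cdot u_k$ is obtained by taking $u_k$ to be the smallest nonempty tail of $w$, then $u_{k-1}$ the smallest nonempty tail of $w$ with $u_k$ removed, and so on; $Z(w)$ is the number of $\sigma\in\mathfrak S_k$ with $u_{\sigma(i)}=u_i$ for all $i$. A Lyndon word $u$ of length greater than $1$ has standard factorisation $u=u_1\cdot u_2$, where $u_2$ is the longest Lyndon tail of $u$ other than $u$. In the free associative algebra over $\mathbb R$ on the letters (basis the words, product concatenation), let $f_w=w$ if $w$ is a single letter; $f_w=f_{u_1}f_{u_2}-f_{u_2}f_{u_1}$ if $w$ is Lyndon with standard factorisation $u_1\cdot u_2$; and $f_w=\frac{1}{Z(w)\,k!}\sum_{\sigma\in\mathfrak S_k}f_{u_{\sigma(1)}}\cdots f_{u_{\sigma(k)}}$ if $w$ has Lyndon factorisation $u_1\cdot\ldots\cdot u_k$. The right eigenfunction $\mathbf f_w$ of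 riffle-shuffling maps a word $v$ to the coefficient of $v$ in $f_w$; it is extended linearly to linear combinations of words. In the shuffle algebra over $\mathbb R$ (basis the words, the product of two words being the sum of all their interleavings with multiplicity, coproduct $\Delta$ deconcatenation, unit the empty word), let $\bar\Delta(x)=\Delta(x)-1\otimes x-x\otimes 1$, let $m^{[r]}$ and $\bar\Delta^{[r]}$ be the $r$-fold product and reduced coproduct, and let $e(x)=\sum_{r\ge1}\frac{(-1)^{r-1}}{r}m^{[r]}\bar\Delta^{[r]}(x)$ be the first Eulerian idempotent. The left eigenfunction $\mathbf g_w$ maps a word $v$ to the coefficient of $v$ in $e(u_1)\cdots e(u_k)$ (shuffle product), where $w=u_1\cdot\ldots\cdot u_k$ is the Lyndon factorisation. Write $\langle\mathbf f_{w'},\mathbf g_w\rangle=\sum_v\mathbf f_{w'}(v)\,\mathbf g_w(v)$, summing over all words $v$ (only finitely many terms are non-zero). Theorem. Let $w,w'$ be words with Lyndon factorisations $w=u_1\cdot\ldots\cdot u_k$ and $w'=u'_1\cdot\ldots\cdot u'_{k'}$. If $k\ne k'$, then $\langle\mathbf f_{w'},\mathbf g_w\rangle=0$. If $k=k'$, then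 $$\langle\mathbf f_{w'},\mathbf g_w\rangle=\frac{1}{Z(w')}\sum_{\sigma\in\mathfrak S_k}\mathbf f_{u'_{\sigma(1)}}(u_1)\cdots\mathbf f_{u'_{\sigma(k)}}(u_k)=\mathbf f_{w'}(u_1\cdots u_k),$$ where $u_1\cdots u_k$ is the shuffle product of the Lyndon factors of $w$ (not their concatenation). In particular, $\langle\mathbf f_w,\mathbf g_w\rangle=1$, and $\langle\mathbf f_{w'},\mathbf g_w\rangle$ is non-zero only when $k=k'$ and there is a permutation $\sigma\in\mathfrak S_k$ such that, for each $i$, $\deg(u'_{\sigma(i)})=\deg(u_i)$ and $u_i$ is equal to or lexicographically larger than $u'_{\sigma(i)}$. -/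

import Mathlib

open scoped TensorProduct

noncomputable section

namespace RiffleShuffle

section Lyndon

variable {α : Type*} [LinearOrder α]

/-! ### Lyndon words

Words are lists of letters from a totally ordered alphabet; `<` and `≤` on lists is the
lexicographic order, in which a proper prefix is smaller. -/

/-- A nonempty word is Lyndon if it is strictly smaller than each of its (nontrivial) cyclic
rearrangements. -/
def IsLyndon (w : List α) : Prop :=
  w ≠ [] ∧ ∀ i, 0 < i → i < w.length → w < w.rotate i

/-- The lexicographically smallest nonempty tail of a nonempty word. -/
def minTail : List α → List α
  | [] => []
  | [a] => [a]
  | a :: b :: l => min (a :: b :: l) (minTail (b :: l))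

lemma minTail_length_pos : ∀ w : List α, w ≠ [] → 0 < (minTail w).length
  | [], h => absurd rfl h
  | [a], _ => by simp [minTail]
  | a :: b :: l, _ => by
    rw [minTail]
    rcases min_choice (a :: b :: l) (minTail (b :: l)) with h | h <;> rw [h]
    · simp
    · exact minTail_length_pos (b :: l) (by simp)

/-- The Lyndon factorisation `[u₁, …, u_k]` of a word `w`: the last factor `u_k` is the smallest
nonempty tail of `w`, then `u_{k-1}` is the smallest nonempty tail of `w` with `u_k` removed,
and so on. -/
def lyndonFactors (w : List α) : List (List α) :=
  if _h : w = [] then []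
  else lyndonFactors (w.take (w.length - (minTail w).length)) ++ [minTail w]
termination_by w.length
decreasing_by
  have h1 := minTail_length_pos w _h
  have h2 : 0 < w.length := List.length_pos_iff.mpr _h
  simp only [List.length_take]
  omega

/-- `k(w)`, the number of Lyndon factors of `w`. -/
def numFactors (w : List α) : ℕ := (lyndonFactors w).length

/-- The `i`-th Lyndon factor of `w`. -/
def factor (w : List α) (i : Fin (numFactors w)) : List α := (lyndonFactors w).get i

/-- `Z(w)`, the number of permutations in `𝔖_{k(w)}` which fix the sequence of Lyndon factors. -/
def stabCard (w : List α) : ℕ :=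
  Nat.card {σ : Equiv.Perm (Fin (numFactors w)) // ∀ i, factor w (σ i) = factor w i}

/-- The degree (evaluation) of a word: the number of occurrences of each letter. -/
def deg (w : List α) : α → ℕ := fun a => w.count a

open Classical in
/-- The longest Lyndon tail of a word (possibly the word itself). -/
def longestLyndonTail : List α → List α
  | [] => []
  | a :: l => if IsLyndon (a :: l) then a :: l else longestLyndonTail l

/-- The right part of the standard factorisation: the longest Lyndon tail of `u` that is not
`u` itself. -/
def stdRight (u : List α) : List α := longestLyndonTail u.tail

/-- The left part of the standard factorisation: the corresponding head. -/
def stdLeft (u : List α) : List α := u.take (u.length - (stdRight u).length)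

lemma longestLyndonTail_length_le : ∀ w : List α, (longestLyndonTail w).length ≤ w.length
  | [] => by simp [longestLyndonTail]
  | a :: l => by
    rw [longestLyndonTail]
    split_ifs
    · exact le_rfl
    · exact (longestLyndonTail_length_le l).trans (by simp)

lemma longestLyndonTail_length_pos :
    ∀ w : List α, w ≠ [] → 0 < (longestLyndonTail w).length
  | [], h => absurd rfl h
  | [a], _ => by
    have h : IsLyndon [a] := ⟨by simp, fun i h1 h2 => by simp at h2; omega⟩
    simp [longestLyndonTail, h]
  | a :: b :: l, _ => by
    rw [longestLyndonTail]
    split_ifs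
    · simp
    · exact longestLyndonTail_length_pos (b :: l) (by simp)

lemma stdRight_length_lt (u : List α) (h : 1 < u.length) : (stdRight u).length < u.length := by
  have := longestLyndonTail_length_le u.tail
  simp only [List.length_tail] at this
  unfold stdRight
  omega

lemma stdLeft_length_lt (u : List α) (h : 1 < u.length) : (stdLeft u).length < u.length := by
  have h0 : u.tail ≠ [] := by
    intro h'
    have := congrArg List.length h'
    simp at this
    omega
  have := longestLyndonTail_length_pos u.tail h0
  unfold stdLeft stdRight
  simp only [List.length_take]
  omega

/-! ### Right eigenfunctions, in the free associative algebra -/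

/-- The free associative algebra on the letters, with basis the words and concatenation product. -/
abbrev FreeAssoc (α : Type*) := MonoidAlgebra ℝ (FreeMonoid α)

/-- The standard bracketing of a Lyndon word `u`: the word itself if it is a single letter, and
the commutator of the standard bracketings of `u₁` and `u₂` if `u` has standard factorisation
`u₁ · u₂`. (The value at words that are not Lyndon is never used.) -/
def stdBracket (u : List α) : FreeAssoc α :=
  if _h : 1 < u.length then
    stdBracket (stdLeft u) * stdBracket (stdRight u)
      - stdBracket (stdRight u) * stdBracket (stdLeft u)
  else MonoidAlgebra.single (FreeMonoid.ofList u) 1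
termination_by u.length
decreasing_by
  all_goals first
    | exact stdLeft_length_lt u _h
    | exact stdRight_length_lt u _h

open Classical in
/-- The vector `f_w` of the free associative algebra: the standard bracketing if `w` is Lyndon,
and `1 / (Z(w) k!) ∑_σ f_{u_{σ(1)}} ⋯ f_{u_{σ(k)}}` if `w` has Lyndon factorisation
`u₁ · … · u_k`. -/
def rightVec (w : List α) : FreeAssoc α :=
  if IsLyndon w then stdBracket w
  else
    (1 / ((stabCard w : ℝ) * ((numFactors w).factorial : ℝ))) •
      ∑ σ : Equiv.Perm (Fin (numFactors w)),
        (List.ofFn fun i => stdBracket (factor w (σ i))).prod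

/-- The right eigenfunction `f_w`: its value at `v` is the coefficient of `v` in the vector. -/
def rightEfn (w v : List α) : ℝ := (rightVec w).coeff (FreeMonoid.ofList v)

end Lyndon

/-! ### Left eigenfunctions, in the shuffle algebra -/

section Shuffle

variable {α : Type*}

/-- The underlying vector space of the shuffle algebra, with basis the words. -/
abbrev Sh (α : Type*) := List α →₀ ℝ

/-- A word, as a basis element of the shuffle algebra. -/
def word (w : List α) : Sh α := Finsupp.single w 1

/-- The list of all interleavings of two words, with multiplicity. -/
def interleavings : List α → List α → List (List α)
  | [], v => [v]
  | a :: u, [] => [a :: u]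
  | a :: u, b :: v =>
    (interleavings u (b :: v)).map (a :: ·) ++ (interleavings (a :: u) v).map (b :: ·)
termination_by u v => u.length + v.length

/-- The shuffle product: the product of two words is the sum of all their interleavings. -/
def shuffleMul : Sh α →ₗ[ℝ] Sh α →ₗ[ℝ] Sh α :=
  Finsupp.linearCombination ℝ fun u =>
    Finsupp.linearCombination ℝ fun v => ((interleavings u v).map word).sum

/-- The shuffle product of a list of elements; the empty word is the unit. -/
def shuffleProd (l : List (Sh α)) : Sh α := l.foldr (fun x y => shuffleMul x y) (word [])

/-- The deconcatenation coproduct `Δ`. -/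
def coprod : Sh α →ₗ[ℝ] Sh α ⊗[ℝ] Sh α :=
  Finsupp.linearCombination ℝ fun w =>
    ∑ i ∈ Finset.range (w.length + 1), word (w.take i) ⊗ₜ[ℝ] word (w.drop i)

/-- The reduced coproduct `x ↦ Δ(x) - 1 ⊗ x - x ⊗ 1`, extended linearly from words. -/
def redCoprod : Sh α →ₗ[ℝ] Sh α ⊗[ℝ] Sh α :=
  Finsupp.linearCombination ℝ fun w =>
    coprod (word w) - word [] ⊗ₜ[ℝ] word w - word w ⊗ₜ[ℝ] word []

/-- `r`-fold reduced coproduct followed by `r`-fold product, for `r ≥ 1`. The reduced coproduct is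
iterated on the last tensor factor: the `(r+1)`-fold one is the reduced coproduct followed by the
`r`-fold one on the second factor, and similarly for the product, by associativity. -/
def prodRedCoprod : ℕ → Sh α →ₗ[ℝ] Sh α
  | 0 => 0
  | 1 => LinearMap.id
  | r + 2 =>
    TensorProduct.lift shuffleMul ∘ₗ
      TensorProduct.map LinearMap.id (prodRedCoprod (r + 1)) ∘ₗ redCoprod

/-- The first Eulerian idempotent `e(x) = ∑_{r ≥ 1} (-1)^(r-1) / r • m^[r] Δ̄^[r] (x)`. On a word
of length `n ≥ 1` the terms with `r > n` vanish, so the sum stops at `n`. -/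
def eulerian : Sh α →ₗ[ℝ] Sh α :=
  Finsupp.linearCombination ℝ fun w =>
    ∑ r ∈ Finset.Icc 1 w.length, ((-1 : ℝ) ^ (r - 1) / (r : ℝ)) • prodRedCoprod r (word w)

end Shuffle

section Left

variable {α : Type*} [LinearOrder α]

/-- The vector `g_w = e(u₁) ⋯ e(u_k)` of the shuffle algebra, where `w` has Lyndon factorisation
`u₁ · … · u_k`. -/
def leftVec (w : List α) : Sh α :=
  shuffleProd ((lyndonFactors w).map fun u => eulerian (word u))

/-- The left eigenfunction `g_w`: its value at `v` is the coefficient of `v` in the vector. -/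
def leftEfn (w v : List α) : ℝ := leftVec w v

end Left

/-! ### The pairing -/

section Pairing

variable {α : Type*}

/-- `⟨f, g⟩ = ∑_v f(v) g(v)`, summing over all words `v`. It is applied only to functions of
finite support. -/
def pairing (f g : List α → ℝ) : ℝ := ∑ᶠ v, f v * g v

/-- The linear extension to the shuffle algebra of a function on words. -/
def linExt (f : List α → ℝ) : Sh α →ₗ[ℝ] ℝ := Finsupp.linearCombination ℝ f

end Pairing

end RiffleShuffle

end

noncomputable section

namespace RiffleShuffle


/-! ### Lexicographic order, Lyndon words and standard factorisation -/

section LyndonTheory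

variable {α : Type*} [LinearOrder α]

/-! The pairing is the duality between the free associative algebra and the shuffle algebra.
Standard bracketings are iterated commutators of letters, hence primitive for the coproduct dual to
the shuffle product (`isPrimitive_stdBracket`), so powers `P ^ n` of a primitive `P` act on shuffle
products by Leibniz' rule.

On the Eulerian idempotent, `P ^ n` picks out the coefficient of `t ^ n` in `log (1 + (exp t - 1)) =
t`: only `n = 1` survives (`IsPrimitive.dualPairing_pow_eulerian`). Hence `P ^ n` kills `leftVec w`
unless `n = k`, and then gives `k! ∏ P(u_i)`. At `n = k` the plain shuffle product of the `u_i`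
gives the same value. By polarization (`sum_perm_eq_sum_diagonal`) the symmetrized product in
`rightVec w'` is a signed sum of `k'`-th powers of primitives, so these values determine the
pairing: zero if `k ≠ k'`, a permanent otherwise.

The last claims come from triangularity (`supportedAbove_stdBracket`): the bracketing of a Lyndon
word `u` is `u` plus larger rearrangements of `u`. On the diagonal only stabilising permutations
contribute, and `Z(w)` cancels. -/

lemma nil_lt_of_ne_nil {l : List α} (h : l ≠ []) : [] < l := by
  cases l with
  | nil => exact absurd rfl h
  | cons a l => exact List.Lex.nil

lemma cons_lt_cons_iff_of_lex {a b : α} {l l' : List α} :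
    a :: l < b :: l' ↔ a < b ∨ a = b ∧ l < l' := by
  constructor
  · rintro (_ | h | h)
    · exact Or.inl ‹_›
    · exact Or.inr ⟨rfl, ‹_›⟩
  · rintro (h | ⟨rfl, h⟩)
    · exact List.Lex.rel h
    · exact List.Lex.cons h

lemma append_lt_append_left_iff (s : List α) {t t' : List α} : s ++ t < s ++ t' ↔ t < t' := by
  induction s with
  | nil => rfl
  | cons a s ih => simp [ih]

lemma append_le_append_left_iff (s : List α) {t t' : List α} : s ++ t ≤ s ++ t' ↔ t ≤ t' := by
  rw [← not_lt, ← not_lt, append_lt_append_left_iff]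

lemma le_append_right (s t : List α) : s ≤ s ++ t := by
  rcases eq_or_ne t [] with rfl | h
  · simp
  · have := (append_lt_append_left_iff s).2 (nil_lt_of_ne_nil h)
    rw [List.append_nil] at this
    exact this.le

/-- A strict inequality not witnessed by a proper prefix survives appending anything. -/
lemma prefix_or_append_lt : ∀ {s t : List α}, s < t →
    s <+: t ∨ ∀ x y : List α, s ++ x < t ++ y
  | [], t, _ => Or.inl (List.nil_prefix)
  | a :: s, [], h => by cases h
  | a :: s, b :: t, h => by
    rcases cons_lt_cons_iff_of_lex.1 h with h | ⟨rfl, h'⟩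
    · exact Or.inr fun x y => List.Lex.rel h
    · rcases prefix_or_append_lt h' with h' | h'
      · exact Or.inl ((List.prefix_cons_inj a).2 h')
      · exact Or.inr fun x y => List.Lex.cons (h' x y)

lemma append_lt_append_of_length_eq {s t : List α} (h : s < t) (hl : s.length = t.length)
    (x y : List α) : s ++ x < t ++ y := by
  rcases prefix_or_append_lt h with hp | hp
  · exact absurd (hp.eq_of_length hl) h.ne
  · exact hp x y

lemma append_le_append_of_length_eq {s t x y : List α} (h : s ≤ t) (hl : s.length = t.length)
    (hxy : x ≤ y) : s ++ x ≤ t ++ y := by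
  rcases h.eq_or_lt with rfl | h
  · exact (append_le_append_left_iff _).2 hxy
  · exact (append_lt_append_of_length_eq h hl x y).le

lemma isLyndon_iff_lt_append {w : List α} :
    IsLyndon w ↔ w ≠ [] ∧ ∀ t s, t ≠ [] → s ≠ [] → w = t ++ s → w < s ++ t := by
  refine and_congr_right fun _ => ⟨fun h t s ht hs hw => ?_, fun h i hi hi' => ?_⟩
  · have := h t.length (List.length_pos_iff.2 ht) (by
      rw [hw, List.length_append]; have := List.length_pos_iff.2 hs; omega)
    rwa [hw, List.rotate_append_length_eq, ← hw] at this
  · rw [List.rotate_eq_drop_append_take hi'.le]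
    refine h _ _ ?_ ?_ (List.take_append_drop i w).symm
    · simp only [ne_eq, List.take_eq_nil_iff, not_or]; exact ⟨by omega, ‹_›⟩
    · simpa using hi'

/-- A nonempty word is Lyndon iff it is smaller than each of its proper nonempty tails. -/
lemma isLyndon_iff_lt_tails {w : List α} :
    IsLyndon w ↔ w ≠ [] ∧ ∀ t s, t ≠ [] → s ≠ [] → w = t ++ s → w < s := by
  rw [isLyndon_iff_lt_append]
  refine and_congr_right fun _ => ⟨fun h t s ht hs hw => ?_, fun h t s ht hs hw =>
    (h t s ht hs hw).trans_le (le_append_right s t)⟩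
  by_contra hlt
  have hne : s ≠ w := by
    intro h
    have h1 := congrArg List.length hw
    rw [h, List.length_append] at h1
    have := List.length_pos_iff.2 ht
    omega
  have hsw : s < w := lt_of_le_of_ne (not_lt.1 hlt) hne
  -- If `s` is a prefix, then `w = t ++ s = s ++ t'`. Cancelling `s` in `w < s ++ t` gives `t' < t`,
  -- so `t' ++ s < w`, against the rotation `w < t' ++ s`.
  rcases prefix_or_append_lt hsw with ⟨t', ht'⟩ | h'
  · have hlen : t'.length = t.length := by
      have h1 := congrArg List.length ht'
      have h2 := congrArg List.length hw
      simp only [List.length_append] at h1 h2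
      omega
    have h1 := h t s ht hs hw
    rw [← ht', append_lt_append_left_iff] at h1
    have h2 := append_lt_append_of_length_eq h1 hlen s s
    have h3 := h s t' hs (by intro h0; apply ht; rw [← List.length_eq_zero_iff]; simp [← hlen, h0])
      ht'.symm
    rw [← hw] at h2
    exact lt_asymm h2 h3
  · have h1 := h' t []
    rw [List.append_nil] at h1
    exact lt_asymm (h t s ht hs hw) h1

lemma minTail_suffix : ∀ w : List α, minTail w <:+ w
  | [] => by simp [minTail]
  | [a] => by simp [minTail]
  | a :: b :: l => by
    rw [minTail]
    rcases min_choice (a :: b :: l) (minTail (b :: l)) with h | h <;> rw [h]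
    exact (minTail_suffix (b :: l)).trans (List.suffix_cons a _)

lemma minTail_ne_nil {w : List α} (h : w ≠ []) : minTail w ≠ [] :=
  List.length_pos_iff.1 (minTail_length_pos w h)

lemma minTail_le : ∀ {w s : List α}, s <:+ w → s ≠ [] → minTail w ≤ s
  | [], s, h, hs => absurd (List.suffix_nil.1 h) hs
  | [a], s, h, hs => by
    rcases List.suffix_cons_iff.1 h with rfl | h
    · simp [minTail]
    · exact absurd (List.suffix_nil.1 h) hs
  | a :: b :: l, s, h, hs => by
    rw [minTail]
    rcases List.suffix_cons_iff.1 h with rfl | h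
    · exact min_le_left _ _
    · exact (min_le_right _ _).trans (minTail_le h hs)

/-- Tails of the smallest tail are tails of `w` too, so none of them can be smaller. -/
lemma isLyndon_minTail {w : List α} (h : w ≠ []) : IsLyndon (minTail w) := by
  rw [isLyndon_iff_lt_tails]
  refine ⟨minTail_ne_nil h, fun t s ht hs hw => ?_⟩
  refine lt_of_le_of_ne (minTail_le ((List.suffix_append t s).trans ?_) hs) ?_
  · rw [← hw]; exact minTail_suffix w
  · intro h'
    rw [hw] at h'
    exact ht (List.append_left_eq_self.1 h')

lemma minTail_eq_self_iff {w : List α} (hw : w ≠ []) : minTail w = w ↔ IsLyndon w := by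
  constructor
  · intro h; rw [← h]; exact isLyndon_minTail hw
  · intro h
    obtain ⟨t, ht⟩ := minTail_suffix w
    rcases eq_or_ne t [] with rfl | h0
    · exact ht
    · exact absurd ((isLyndon_iff_lt_tails.1 h).2 t _ h0 (minTail_ne_nil hw) ht.symm)
        (not_lt.2 (minTail_le List.suffix_rfl hw))

/-- Both recursions stop exactly at a Lyndon tail. Standard factorisation can thus be handled
through minimality instead of length. -/
lemma longestLyndonTail_eq_minTail : ∀ w : List α, longestLyndonTail w = minTail w
  | [] => rfl
  | a :: l => by
    rw [longestLyndonTail]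
    split_ifs with h
    · exact ((minTail_eq_self_iff (by simp)).2 h).symm
    · rw [longestLyndonTail_eq_minTail l]
      cases l with
      | nil => exact absurd ((minTail_eq_self_iff (by simp)).1 rfl) h
      | cons b l =>
        rw [minTail]
        rcases min_choice (a :: b :: l) (minTail (b :: l)) with h' | h'
        · exact absurd ((minTail_eq_self_iff (by simp)).1 (by rw [minTail, h'])) h
        · exact h'.symm

lemma stdRight_eq_minTail (u : List α) : stdRight u = minTail u.tail :=
  longestLyndonTail_eq_minTail _

lemma take_append_of_suffix {β : Type*} {s w : List β} (h : s <:+ w) :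
    w.take (w.length - s.length) ++ s = w := by
  obtain ⟨t, rfl⟩ := h
  simp

lemma stdLeft_append_stdRight (u : List α) : stdLeft u ++ stdRight u = u := by
  refine take_append_of_suffix ?_
  rw [stdRight_eq_minTail]
  exact (minTail_suffix _).trans (List.tail_suffix u)

lemma tail_ne_nil_of_one_lt_length {β : Type*} {u : List β} (h : 1 < u.length) : u.tail ≠ [] := by
  rw [← List.length_pos_iff, List.length_tail]; omega

lemma isLyndon_stdRight {u : List α} (h : 1 < u.length) : IsLyndon (stdRight u) := by
  rw [stdRight_eq_minTail]
  exact isLyndon_minTail (tail_ne_nil_of_one_lt_length h)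

lemma stdLeft_ne_nil {u : List α} (h : 1 < u.length) : stdLeft u ≠ [] := by
  intro h0
  have h1 := congrArg List.length (stdLeft_append_stdRight u)
  have := stdRight_length_lt u h
  simp only [h0, List.length_append, List.length_nil] at h1
  omega

lemma stdRight_le_of_suffix {u t s : List α} (hu : u = t ++ s) (ht : t ≠ []) (hs : s ≠ []) :
    stdRight u ≤ s := by
  rw [stdRight_eq_minTail]
  refine minTail_le ?_ hs
  cases t with
  | nil => exact absurd rfl ht
  | cons a t => rw [hu]; exact List.suffix_append t s

lemma isLyndon_stdLeft {u : List α} (hu : IsLyndon u) (h : 1 < u.length) :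
    IsLyndon (stdLeft u) := by
  rw [isLyndon_iff_lt_tails]
  refine ⟨stdLeft_ne_nil h, fun t s ht hs hw => ?_⟩
  have hsplit := stdLeft_append_stdRight u
  have hR := (isLyndon_stdRight h).1
  have hlt : u < s ++ stdRight u := by
    refine (isLyndon_iff_lt_tails.1 hu).2 t _ ht (by simp [hs]) ?_
    rw [← List.append_assoc, ← hw, hsplit]
  by_contra hns
  have hne : s ≠ stdLeft u := by
    intro h'
    rw [← h'] at hw
    exact ht (List.append_left_eq_self.1 hw.symm)
  -- If `s` is a prefix of the left part, cancelling it in `hlt` produces a tail of `u` below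
  -- `stdRight u`, the smallest proper one. Otherwise `s ++ stdRight u < u`, contradicting `hlt`
  -- directly.
  rcases prefix_or_append_lt (lt_of_le_of_ne (not_lt.1 hns) hne) with ⟨t', ht'⟩ | h'
  · have h1 : u = s ++ (t' ++ stdRight u) := by rw [← List.append_assoc, ht', hsplit]
    have h2 := stdRight_le_of_suffix h1 hs (by simp [hR])
    rw [h1, append_lt_append_left_iff, ← h1] at hlt
    exact absurd hlt (not_lt.2 h2)
  · have := h' (stdRight u) (stdRight u)
    rw [hsplit] at this
    exact lt_asymm this hlt

lemma lyndonFactors_of_isLyndon {w : List α} (h : IsLyndon w) : lyndonFactors w = [w] := by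
  rw [lyndonFactors, dif_neg h.1, (minTail_eq_self_iff h.1).2 h]
  simp [lyndonFactors]

lemma isLyndon_of_mem_lyndonFactors {w u : List α} (hu : u ∈ lyndonFactors w) : IsLyndon u := by
  induction w using lyndonFactors.induct with
  | case1 => simp [lyndonFactors] at hu
  | case2 w hw ih =>
    rw [lyndonFactors, dif_neg hw, List.mem_append, List.mem_singleton] at hu
    rcases hu with hu | rfl
    · exact ih hu
    · exact isLyndon_minTail hw

lemma isLyndon_factor (w : List α) (i : Fin (numFactors w)) : IsLyndon (factor w i) :=
  isLyndon_of_mem_lyndonFactors (List.get_mem _ _)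

/-! ### Coefficients of products and triangularity of bracketings -/

/-- The coefficient of a word in an element of the free associative algebra. -/
abbrev coeffFun {β : Type*} (P : FreeAssoc β) (v : List β) : ℝ := P.coeff (FreeMonoid.ofList v)

lemma coeffFun_mul {β : Type*} (P Q : FreeAssoc β) (v : List β) :
    coeffFun (P * Q) v =
      ∑ i ∈ Finset.range (v.length + 1), coeffFun P (v.take i) * coeffFun Q (v.drop i) := by
  classical
  unfold coeffFun
  rw [MonoidAlgebra.coeff_mul_antidiag P Q (FreeMonoid.ofList v)
    ((Finset.range (v.length + 1)).image
      fun i => (FreeMonoid.ofList (v.take i), FreeMonoid.ofList (v.drop i))), Finset.sum_image]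
  · intro i hi j hj hij
    have := congrArg (fun p => (FreeMonoid.toList p.1).length) hij
    simp only [FreeMonoid.toList_ofList, List.length_take, Finset.coe_range, Set.mem_Iio] at *
    omega
  · rintro ⟨x, y⟩
    simp only [Finset.mem_image, Finset.mem_range, Prod.mk.injEq]
    constructor
    · rintro ⟨i, -, rfl, rfl⟩
      rw [← FreeMonoid.ofList_append, List.take_append_drop]
    · intro h
      have h' : x.toList ++ y.toList = v := congrArg FreeMonoid.toList h
      refine ⟨x.toList.length, ?_, ?_, ?_⟩
      · rw [← h', List.length_append]; omega
      · rw [← h', List.take_left]; rfl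
      · rw [← h', List.drop_left]; rfl

/-- `P` is supported on rearrangements `v` of `u` with `u ≤ v`. -/
def SupportedAbove (u : List α) (P : FreeAssoc α) : Prop :=
  ∀ v, coeffFun P v ≠ 0 → v.Perm u ∧ u ≤ v

/-- `P` is homogeneous of degree `u.length`, so only one cut of `w` contributes. -/
lemma SupportedAbove.coeffFun_mul_eq {u w : List α} {P Q : FreeAssoc α}
    (hP : SupportedAbove u P) (hw : u.length ≤ w.length) :
    coeffFun (P * Q) w = coeffFun P (w.take u.length) * coeffFun Q (w.drop u.length) := by
  rw [coeffFun_mul]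
  refine Finset.sum_eq_single_of_mem _ (by simp; omega) fun i hi hne => ?_
  by_contra h
  have h1 := (hP _ (left_ne_zero_of_mul h)).1.length_eq
  simp only [Finset.mem_range, List.length_take] at hi h1
  omega

lemma SupportedAbove.mul {u v : List α} {P Q : FreeAssoc α} (hP : SupportedAbove u P)
    (hQ : SupportedAbove v Q) : SupportedAbove (u ++ v) (P * Q) := by
  intro w hw
  rw [coeffFun_mul] at hw
  obtain ⟨i, -, hi⟩ := Finset.exists_ne_zero_of_sum_ne_zero hw
  obtain ⟨h1, h2⟩ := hP _ (left_ne_zero_of_mul hi)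
  obtain ⟨h3, h4⟩ := hQ _ (right_ne_zero_of_mul hi)
  rw [← List.take_append_drop i w]
  exact ⟨h1.append h3, append_le_append_of_length_eq h2 h1.length_eq.symm h4⟩

/-- In the commutator, the first product has leading word `u`; the second is supported above a
rotation of `u`, which is strictly larger because `u` is Lyndon, so it cannot disturb the
coefficient at `u`. -/
lemma supportedAbove_stdBracket (u : List α) (hu : IsLyndon u) :
    SupportedAbove u (stdBracket u) ∧ coeffFun (stdBracket u) u = 1 := by
  induction u using stdBracket.induct with
  | case1 u h ihL ihR =>
    obtain ⟨hL, hL1⟩ := ihL (isLyndon_stdLeft hu h)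
    obtain ⟨hR, hR1⟩ := ihR (isLyndon_stdRight h)
    have hsplit := stdLeft_append_stdRight u
    have hLR := hL.mul hR
    have hRL := hR.mul hL
    have hlt : u < stdRight u ++ stdLeft u :=
      (isLyndon_iff_lt_append.1 hu).2 _ _ (stdLeft_ne_nil h) (isLyndon_stdRight h).1 hsplit.symm
    rw [hsplit] at hLR
    rw [stdBracket, dif_pos h]
    have hsub : ∀ v, coeffFun (stdBracket (stdLeft u) * stdBracket (stdRight u)
        - stdBracket (stdRight u) * stdBracket (stdLeft u)) v =
        coeffFun (stdBracket (stdLeft u) * stdBracket (stdRight u)) v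
        - coeffFun (stdBracket (stdRight u) * stdBracket (stdLeft u)) v := fun v => rfl
    constructor
    · intro v hv
      rw [hsub] at hv
      by_cases h0 : coeffFun (stdBracket (stdLeft u) * stdBracket (stdRight u)) v = 0
      · obtain ⟨h1, h2⟩ := hRL v (by intro h'; simp [h0, h'] at hv)
        refine ⟨h1.trans ?_, hlt.le.trans h2⟩
        conv_rhs => rw [← hsplit]
        exact List.perm_append_comm
      · exact hLR v h0
    · rw [hsub]
      have h0 : coeffFun (stdBracket (stdRight u) * stdBracket (stdLeft u)) u = 0 := by
        by_contra h'
        exact absurd (hRL u h').2 (not_le.2 hlt)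
      have h1 : coeffFun (stdBracket (stdLeft u) * stdBracket (stdRight u)) u = 1 := by
        have h2 : (stdLeft u).length ≤ u.length := (stdLeft_length_lt u h).le
        have h3 := List.take_left (l₁ := stdLeft u) (l₂ := stdRight u)
        have h4 := List.drop_left (l₁ := stdLeft u) (l₂ := stdRight u)
        rw [hsplit] at h3 h4
        rw [hL.coeffFun_mul_eq h2, h3, h4, hL1, hR1, mul_one]
      rw [h0, h1, sub_zero]
  | case2 u h =>
    rw [stdBracket, dif_neg h]
    constructor
    · intro v hv
      have : v = u := by
        by_contra hne
        exact hv (Finsupp.single_eq_of_ne hne)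
      subst this
      exact ⟨List.Perm.refl _, le_rfl⟩
    · exact Finsupp.single_eq_same

end LyndonTheory


/-! ### Deconcatenation, shuffles and their duality -/

section ShuffleDuality

variable {α : Type*}

/-- The sum of `H x y` over all deconcatenations `x ++ y` of a word. -/
def deconcSum (H : List α → List α → ℝ) : List α → ℝ
  | [] => H [] []
  | a :: z => H [] (a :: z) + deconcSum (fun x y => H (a :: x) y) z

/-- The sum of `F` over all interleavings of two words. -/
def shuffleSum (F : List α → ℝ) (u v : List α) : ℝ := ((interleavings u v).map F).sum

/-- The counit of the shuffle algebra on words. -/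
def counit (u : List α) : ℝ := if u = [] then 1 else 0

@[simp] lemma counit_nil : counit ([] : List α) = 1 := if_pos rfl

@[simp] lemma counit_cons (a : α) (l : List α) : counit (a :: l) = 0 := if_neg (by simp)

lemma deconcSum_eq_sum_range (H : List α → List α → ℝ) (w : List α) :
    deconcSum H w = ∑ i ∈ Finset.range (w.length + 1), H (w.take i) (w.drop i) := by
  induction w generalizing H with
  | nil => simp [deconcSum]
  | cons a z ih =>
    rw [deconcSum, ih, List.length_cons, Finset.sum_range_succ' _ (z.length + 1), add_comm]
    rfl

lemma deconcSum_congr {H K : List α → List α → ℝ} {w : List α}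
    (h : ∀ x y, x ++ y = w → H x y = K x y) : deconcSum H w = deconcSum K w := by
  simp only [deconcSum_eq_sum_range]
  exact Finset.sum_congr rfl fun i _ => h _ _ (List.take_append_drop i w)

lemma deconcSum_add (H K : List α → List α → ℝ) (w : List α) :
    deconcSum (fun x y => H x y + K x y) w = deconcSum H w + deconcSum K w := by
  simp only [deconcSum_eq_sum_range, Finset.sum_add_distrib]

lemma deconcSum_sum {ι : Type*} (s : Finset ι) (H : ι → List α → List α → ℝ) (w : List α) :
    deconcSum (fun x y => ∑ j ∈ s, H j x y) w = ∑ j ∈ s, deconcSum (H j) w := by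
  simp only [deconcSum_eq_sum_range]
  exact Finset.sum_comm

lemma deconcSum_mul_left (c : ℝ) (H : List α → List α → ℝ) (w : List α) :
    deconcSum (fun x y => c * H x y) w = c * deconcSum H w := by
  simp only [deconcSum_eq_sum_range, Finset.mul_sum]

lemma deconcSum_mul_right (c : ℝ) (H : List α → List α → ℝ) (w : List α) :
    deconcSum (fun x y => H x y * c) w = deconcSum H w * c := by
  simp only [deconcSum_eq_sum_range, Finset.sum_mul]

lemma deconcSum_counit_left (F : List α → ℝ) (w : List α) :
    deconcSum (fun x y => counit x * F y) w = F w := by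
  cases w with
  | nil => simp [deconcSum]
  | cons a z => simp [deconcSum, deconcSum_eq_sum_range]

lemma deconcSum_counit_right (F : List α → ℝ) (w : List α) :
    deconcSum (fun x y => F x * counit y) w = F w := by
  induction w generalizing F with
  | nil => simp [deconcSum]
  | cons a z ih => simp [deconcSum, ih]

lemma shuffleSum_nil_left (F : List α → ℝ) (v : List α) : shuffleSum F [] v = F v := by
  simp [shuffleSum, interleavings]

lemma shuffleSum_nil_right (F : List α → ℝ) (u : List α) : shuffleSum F u [] = F u := by
  cases u <;> simp [shuffleSum, interleavings]

lemma shuffleSum_cons_cons (F : List α → ℝ) (a b : α) (u v : List α) :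
    shuffleSum F (a :: u) (b :: v) =
      shuffleSum (fun z => F (a :: z)) u (b :: v) + shuffleSum (fun z => F (b :: z)) (a :: u) v := by
  simp [shuffleSum, interleavings, Function.comp_def]

lemma shuffleSum_add (F G : List α → ℝ) (u v : List α) :
    shuffleSum (fun z => F z + G z) u v = shuffleSum F u v + shuffleSum G u v := by
  simp [shuffleSum, List.sum_map_add]

lemma shuffleSum_mul_left (c : ℝ) (F : List α → ℝ) (u v : List α) :
    shuffleSum (fun z => c * F z) u v = c * shuffleSum F u v := by
  simp [shuffleSum, List.sum_map_mul_left]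

lemma shuffleSum_mul_right (c : ℝ) (F : List α → ℝ) (u v : List α) :
    shuffleSum (fun z => F z * c) u v = shuffleSum F u v * c := by
  simp [shuffleSum, List.sum_map_mul_right]

/-- Deconcatenation is multiplicative for the shuffle product. -/
lemma shuffleSum_deconcSum (H : List α → List α → ℝ) (u v : List α) :
    shuffleSum (deconcSum H) u v =
      deconcSum (fun u₁ u₂ => deconcSum (fun v₁ v₂ =>
        shuffleSum (fun z₁ => shuffleSum (H z₁) u₂ v₂) u₁ v₁) v) u := by
  induction u, v using interleavings.induct generalizing H with
  | case1 v => simp [shuffleSum_nil_left, deconcSum]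
  | case2 a u => simp only [shuffleSum_nil_right, deconcSum]
  | case3 a u b v ih1 ih2 =>
    rw [shuffleSum_cons_cons]
    simp only [deconcSum, shuffleSum_add, ih1, ih2, shuffleSum_nil_left, shuffleSum_nil_right,
      deconcSum_add, shuffleSum_cons_cons]
    ring

lemma coeffFun_mul_eq_deconcSum (P Q : FreeAssoc α) (w : List α) :
    coeffFun (P * Q) w = deconcSum (fun x y => coeffFun P x * coeffFun Q y) w := by
  rw [coeffFun_mul, deconcSum_eq_sum_range]

lemma coeffFun_one (w : List α) : coeffFun (1 : FreeAssoc α) w = counit w := by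
  cases w with
  | nil => exact Finsupp.single_eq_same
  | cons a w => exact Finsupp.single_eq_of_ne (List.cons_ne_nil a w)

/-- The coproduct dual to the shuffle product is multiplicative for concatenation. -/
lemma shuffleSum_coeffFun_mul (P Q : FreeAssoc α) (u v : List α) :
    shuffleSum (coeffFun (P * Q)) u v =
      deconcSum (fun u₁ u₂ => deconcSum (fun v₁ v₂ =>
        shuffleSum (coeffFun P) u₁ v₁ * shuffleSum (coeffFun Q) u₂ v₂) v) u := by
  have : coeffFun (P * Q) = deconcSum (fun x y => coeffFun P x * coeffFun Q y) :=
    funext fun w => coeffFun_mul_eq_deconcSum P Q w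
  rw [this, shuffleSum_deconcSum]
  simp only [shuffleSum_mul_left, shuffleSum_mul_right]

/-! ### Primitive elements and their powers -/

/-- `P` is primitive for the coproduct dual to the shuffle product. -/
def IsPrimitive (P : FreeAssoc α) : Prop :=
  ∀ u v, shuffleSum (coeffFun P) u v = coeffFun P u * counit v + counit u * coeffFun P v

lemma IsPrimitive.coeffFun_nil {P : FreeAssoc α} (hP : IsPrimitive P) : coeffFun P [] = 0 := by
  have := hP [] []
  rw [shuffleSum_nil_left, counit_nil] at this
  linarith

lemma coeffFun_sub (P Q : FreeAssoc α) (v : List α) :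
    coeffFun (P - Q) v = coeffFun P v - coeffFun Q v := rfl

lemma shuffleSum_coeffFun_sub (P Q : FreeAssoc α) (u v : List α) :
    shuffleSum (coeffFun (P - Q)) u v =
      shuffleSum (coeffFun P) u v - shuffleSum (coeffFun Q) u v := by
  have : coeffFun P = fun z => coeffFun (P - Q) z + coeffFun Q z := by
    funext z; rw [coeffFun_sub]; ring
  conv_rhs => rw [this, shuffleSum_add]
  ring

lemma IsPrimitive.add {P Q : FreeAssoc α} (hP : IsPrimitive P) (hQ : IsPrimitive Q) :
    IsPrimitive (P + Q) := by
  intro u v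
  have : coeffFun (P + Q) = fun z => coeffFun P z + coeffFun Q z := rfl
  rw [this, shuffleSum_add, hP, hQ]
  ring

lemma isPrimitive_zero : IsPrimitive (0 : FreeAssoc α) := by
  intro u v
  have : coeffFun (0 : FreeAssoc α) = fun _ => 0 := rfl
  simp [this, shuffleSum]

lemma IsPrimitive.sum {ι : Type*} (s : Finset ι) {P : ι → FreeAssoc α}
    (h : ∀ i, IsPrimitive (P i)) : IsPrimitive (∑ i ∈ s, P i) :=
  Finset.sum_induction P IsPrimitive (fun _ _ => IsPrimitive.add) isPrimitive_zero fun i _ => h i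

/-- This expands `(P ⊗ 1 + 1 ⊗ P)(Q ⊗ 1 + 1 ⊗ Q)`. The mixed terms are symmetric in `P` and `Q`, so
they cancel in a commutator. -/
lemma IsPrimitive.shuffleSum_mul {P Q : FreeAssoc α} (hP : IsPrimitive P) (hQ : IsPrimitive Q)
    (u v : List α) : shuffleSum (coeffFun (P * Q)) u v =
      coeffFun (P * Q) u * counit v + coeffFun P u * coeffFun Q v
      + coeffFun Q u * coeffFun P v + counit u * coeffFun (P * Q) v := by
  rw [shuffleSum_coeffFun_mul]
  have : ∀ u₁ u₂ v₁ v₂ : List α,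
      shuffleSum (coeffFun P) u₁ v₁ * shuffleSum (coeffFun Q) u₂ v₂ =
      coeffFun P u₁ * coeffFun Q u₂ * (counit v₁ * counit v₂) +
      coeffFun P u₁ * counit u₂ * (counit v₁ * coeffFun Q v₂) +
      counit u₁ * coeffFun Q u₂ * (coeffFun P v₁ * counit v₂) +
      counit u₁ * counit u₂ * (coeffFun P v₁ * coeffFun Q v₂) := by
    intros; rw [hP, hQ]; ring
  simp only [this, deconcSum_add, deconcSum_mul_left, deconcSum_mul_right, deconcSum_counit_left,
    deconcSum_counit_right, ← coeffFun_mul_eq_deconcSum]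

lemma IsPrimitive.commutator {P Q : FreeAssoc α} (hP : IsPrimitive P) (hQ : IsPrimitive Q) :
    IsPrimitive (P * Q - Q * P) := by
  intro u v
  rw [shuffleSum_coeffFun_sub, hP.shuffleSum_mul hQ, hQ.shuffleSum_mul hP]
  simp only [coeffFun_sub]
  ring

lemma length_of_mem_interleavings {u v z : List α} (h : z ∈ interleavings u v) :
    z.length = u.length + v.length := by
  induction u, v using interleavings.induct generalizing z with
  | case1 v => simp_all [interleavings]
  | case2 a u => simp_all [interleavings]
  | case3 a u b v ih1 ih2 =>
    simp only [interleavings, List.mem_append, List.mem_map] at h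
    rcases h with ⟨y, hy, rfl⟩ | ⟨y, hy, rfl⟩
    · simp only [List.length_cons, ih1 hy]; omega
    · simp only [List.length_cons, ih2 hy]; omega

/-- Interleavings of two nonempty words have length at least two, so they miss the letter. -/
lemma isPrimitive_letter {u : List α} (hu : u.length = 1) :
    IsPrimitive (MonoidAlgebra.single (FreeMonoid.ofList u) 1 : FreeAssoc α) := by
  have h0 : ∀ z : List α, z.length ≠ 1 →
      coeffFun (MonoidAlgebra.single (FreeMonoid.ofList u) 1 : FreeAssoc α) z = 0 := by
    intro z hz
    refine Finsupp.single_eq_of_ne ?_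
    rintro h
    exact hz (by rw [← hu]; exact congrArg (fun x => (FreeMonoid.toList x).length) h)
  intro x y
  cases x with
  | nil => rw [shuffleSum_nil_left, h0 [] (by simp)]; simp
  | cons a x =>
    cases y with
    | nil => rw [shuffleSum_nil_right, h0 [] (by simp)]; simp
    | cons b y =>
      rw [counit_cons, counit_cons, mul_zero, zero_mul, add_zero]
      refine List.sum_eq_zero fun r hr => ?_
      obtain ⟨z, hz, rfl⟩ := List.mem_map.1 hr
      refine h0 z ?_
      rw [length_of_mem_interleavings hz, List.length_cons, List.length_cons]
      omega

lemma isPrimitive_stdBracket [LinearOrder α] (u : List α) (hu : u ≠ []) :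
    IsPrimitive (stdBracket u) := by
  induction u using stdBracket.induct with
  | case1 u h ihL ihR =>
    rw [stdBracket, dif_pos h]
    exact (ihL (stdLeft_ne_nil h)).commutator (ihR (isLyndon_stdRight h).1)
  | case2 u h =>
    rw [stdBracket, dif_neg h]
    refine isPrimitive_letter ?_
    have := List.length_pos_iff.2 hu
    omega

/-- The binomial theorem for `(P ⊗ 1 + 1 ⊗ P) ^ n`, whose two summands commute; the induction step
is Pascal's rule. -/
lemma IsPrimitive.shuffleSum_pow {P : FreeAssoc α} (hP : IsPrimitive P) (n : ℕ) (u v : List α) :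
    shuffleSum (coeffFun (P ^ n)) u v =
      ∑ p ∈ Finset.HasAntidiagonal.antidiagonal n,
        (n.choose p.1 : ℝ) * (coeffFun (P ^ p.1) u * coeffFun (P ^ p.2) v) := by
  induction n generalizing u v with
  | zero =>
    have h : coeffFun (1 : FreeAssoc α) = counit := funext coeffFun_one
    simp only [Finset.HasAntidiagonal.antidiagonal_zero, Finset.sum_singleton, pow_zero, Nat.choose_self,
      Nat.cast_one, one_mul, h, coeffFun_one]
    cases u with
    | nil => simp [shuffleSum_nil_left]
    | cons a u =>
      rw [counit_cons, zero_mul]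
      refine List.sum_eq_zero fun r hr => ?_
      obtain ⟨z, hz, rfl⟩ := List.mem_map.1 hr
      refine if_neg fun hz0 => ?_
      have := length_of_mem_interleavings hz
      simp only [hz0, List.length_nil, List.length_cons] at this
      omega
  | succ n ih =>
    rw [pow_succ', shuffleSum_coeffFun_mul]
    have : ∀ u₁ u₂ v₁ v₂ : List α,
        shuffleSum (coeffFun P) u₁ v₁ * shuffleSum (coeffFun (P ^ n)) u₂ v₂ =
        ∑ p ∈ Finset.HasAntidiagonal.antidiagonal n, ((n.choose p.1 : ℝ) *
          (coeffFun P u₁ * coeffFun (P ^ p.1) u₂ * (counit v₁ * coeffFun (P ^ p.2) v₂)) +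
          (n.choose p.1 : ℝ) *
          (counit u₁ * coeffFun (P ^ p.1) u₂ * (coeffFun P v₁ * coeffFun (P ^ p.2) v₂))) := by
      intro u₁ u₂ v₁ v₂
      rw [hP, ih, Finset.mul_sum]
      exact Finset.sum_congr rfl fun _ _ => by ring
    simp only [this, deconcSum_sum, deconcSum_add, deconcSum_mul_left, deconcSum_mul_right,
      deconcSum_counit_left, ← coeffFun_mul_eq_deconcSum, ← pow_succ', Finset.sum_add_distrib]
    rw [Finset.sum_antidiagonal_choose_succ_mul
      (fun i j => coeffFun (P ^ i) u * coeffFun (P ^ j) v) n, add_comm]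
    congr 1
    refine Finset.sum_congr rfl fun p hp => ?_
    rw [← Finset.HasAntidiagonal.mem_antidiagonal.1 hp, Nat.choose_symm_add]

/-- The pairing of the free associative algebra with the shuffle algebra. -/
def dualPairing (P : FreeAssoc α) : Sh α →ₗ[ℝ] ℝ := linExt (coeffFun P)

@[simp] lemma dualPairing_word (P : FreeAssoc α) (w : List α) :
    dualPairing P (word w) = coeffFun P w := by
  simp [dualPairing, linExt, word]

lemma shuffleMul_word_word (u v : List α) :
    shuffleMul (word u) (word v) = ((interleavings u v).map word).sum := by
  simp [shuffleMul, word]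

lemma dualPairing_shuffleMul_word (P : FreeAssoc α) (u v : List α) :
    dualPairing P (shuffleMul (word u) (word v)) = shuffleSum (coeffFun P) u v := by
  rw [shuffleMul_word_word, map_list_sum, List.map_map]
  simp [shuffleSum, Function.comp_def]

/-- Leibniz' rule for the powers of a primitive element. -/
lemma IsPrimitive.dualPairing_pow_shuffleMul {P : FreeAssoc α} (hP : IsPrimitive P) (n : ℕ)
    (x y : Sh α) : dualPairing (P ^ n) (shuffleMul x y) =
      ∑ p ∈ Finset.HasAntidiagonal.antidiagonal n,
        (n.choose p.1 : ℝ) * (dualPairing (P ^ p.1) x * dualPairing (P ^ p.2) y) := by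
  induction x using Finsupp.induction_linear with
  | zero => simp
  | add x x' hx hx' =>
    simp only [map_add, LinearMap.add_apply, hx, hx', add_mul, mul_add, Finset.sum_add_distrib]
  | single u a =>
    induction y using Finsupp.induction_linear with
    | zero => simp
    | add y y' hy hy' => simp only [map_add, hy, hy', mul_add, Finset.sum_add_distrib]
    | single v b =>
      have ha : Finsupp.single u a = a • word u := by simp [word]
      have hb : Finsupp.single v b = b • word v := by simp [word]
      rw [ha, hb]
      simp only [map_smul, LinearMap.smul_apply, dualPairing_shuffleMul_word, hP.shuffleSum_pow,
        dualPairing_word, smul_eq_mul, Finset.mul_sum]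
      exact Finset.sum_congr rfl fun _ _ => by ring

end ShuffleDuality


/-! ### The Eulerian idempotent and powers of primitives -/

section Eulerian

open PowerSeries

/-- The coefficient of `t ^ n` in `(exp t - 1) ^ r`. -/
def expSubOneCoeff (n r : ℕ) : ℝ := coeff n ((exp ℝ - 1 : ℝ⟦X⟧) ^ r)

lemma coeff_exp_sub_one (n : ℕ) :
    coeff n (exp ℝ - 1 : ℝ⟦X⟧) = if n = 0 then 0 else (1 : ℝ) / n.factorial := by
  rw [map_sub, coeff_exp, coeff_one]
  split_ifs with h
  · simp [h]
  · simp

lemma expSubOneCoeff_one (n : ℕ) :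
    expSubOneCoeff n 1 = if n = 0 then 0 else (1 : ℝ) / n.factorial := by
  rw [expSubOneCoeff, pow_one, coeff_exp_sub_one]

lemma expSubOneCoeff_succ (n r : ℕ) :
    expSubOneCoeff n (r + 1) = ∑ p ∈ Finset.HasAntidiagonal.antidiagonal n,
      (if p.1 = 0 then 0 else (1 : ℝ) / p.1.factorial) * expSubOneCoeff p.2 r := by
  rw [expSubOneCoeff, pow_succ', coeff_mul]
  simp only [coeff_exp_sub_one, expSubOneCoeff]

lemma expSubOneCoeff_of_lt {n r : ℕ} (h : n < r) : expSubOneCoeff n r = 0 := by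
  have h1 : (X : ℝ⟦X⟧) ∣ exp ℝ - 1 := by
    rw [X_dvd_iff]; simp
  exact X_pow_dvd_iff.1 (pow_dvd_pow_of_dvd h1 r) n h

/-- Differentiate `(exp t - 1) ^ (r + 1)` and write `exp t = (exp t - 1) + 1`. -/
lemma expSubOneCoeff_succ_succ (n r : ℕ) :
    expSubOneCoeff (n + 1) (r + 1) * (n + 1) =
      (r + 1) * (expSubOneCoeff n (r + 1) + expSubOneCoeff n r) := by
  have h1 : PowerSeries.derivative ℝ ((exp ℝ - 1 : ℝ⟦X⟧) ^ (r + 1)) =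
      ((r + 1 : ℕ) : ℝ) • ((exp ℝ - 1 : ℝ⟦X⟧) ^ (r + 1) + (exp ℝ - 1 : ℝ⟦X⟧) ^ r) := by
    have hd : PowerSeries.derivative ℝ (exp ℝ - 1 : ℝ⟦X⟧) = exp ℝ := by
      rw [map_sub, Derivation.map_one_eq_zero, sub_zero]
      ext m
      rw [PowerSeries.coeff_derivative, coeff_exp, coeff_exp, Nat.factorial_succ]
      simp
      field_simp
    rw [Derivation.leibniz_pow, hd, Nat.add_sub_cancel, Nat.cast_smul_eq_nsmul, smul_eq_mul]
    congr 1
    ring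
  have h2 := congrArg (coeff n) h1
  rw [PowerSeries.coeff_derivative] at h2
  rw [expSubOneCoeff, h2]
  simp [expSubOneCoeff, mul_add]

/-- This is `log (1 + (exp t - 1)) = t` read off at `t ^ n`. Stopping at `N ≥ n` loses nothing,
since `(exp t - 1) ^ r` has order `r`. -/
lemma sum_expSubOneCoeff {n N : ℕ} (hn : n ≠ 0) (hN : n ≤ N) :
    ∑ r ∈ Finset.Icc 1 N, (-1 : ℝ) ^ (r - 1) / (r : ℝ) * expSubOneCoeff n r =
      if n = 1 then 1 else 0 := by
  obtain ⟨n, rfl⟩ := Nat.exists_eq_succ_of_ne_zero hn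
  -- By the derivative recurrence the factor `r` cancels and the alternating sum telescopes.
  have key : ∀ N : ℕ,
      (∑ r ∈ Finset.Icc 1 N, (-1 : ℝ) ^ (r - 1) / (r : ℝ) * expSubOneCoeff (n + 1) r) * (n + 1)
        = expSubOneCoeff n 0 - (-1) ^ N * expSubOneCoeff n N := by
    intro N
    induction N with
    | zero => simp
    | succ N ih =>
      rw [Finset.sum_Icc_succ_top (by omega), add_mul, ih, mul_assoc, expSubOneCoeff_succ_succ]
      have : (N : ℝ) + 1 ≠ 0 := by positivity
      simp only [Nat.add_sub_cancel, Nat.cast_add, Nat.cast_one, pow_succ]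
      field_simp
      ring
  have h := key N
  rw [expSubOneCoeff_of_lt (show n < N from hN), mul_zero, sub_zero, expSubOneCoeff, pow_zero,
    coeff_one] at h
  have hpos : (n : ℝ) + 1 ≠ 0 := by positivity
  rw [eq_div_of_mul_eq hpos h]
  by_cases h0 : n = 0
  · simp [h0]
  · simp [h0]

variable {α : Type*}

/-- Passing to the reduced coproduct replaces `K` by `L`, its truncation to zero on the boundary; as
`w` is nonempty, the two removed cuts are distinct. -/
lemma deconcSum_sub_boundary {K L : List α → List α → ℝ} {w : List α} (hw : w ≠ [])
    (h : ∀ x y, x ≠ [] → y ≠ [] → L x y = K x y) (hl : ∀ y, L [] y = 0) (hr : ∀ x, L x [] = 0) :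
    deconcSum K w - K [] w - K w [] = deconcSum L w := by
  have : deconcSum K w =
      deconcSum (fun x y => L x y + counit x * K [] y + K x [] * counit y) w := by
    refine deconcSum_congr fun x y hxy => ?_
    cases x with
    | nil =>
      cases y with
      | nil => exact absurd hxy.symm hw
      | cons b y => simp [hl]
    | cons a x =>
      cases y with
      | nil => simp [hr]
      | cons b y => simp [h]
  rw [this, deconcSum_add, deconcSum_add, deconcSum_counit_left, deconcSum_counit_right]
  ring

lemma map_redCoprod_word {K : List α → List α → ℝ} (φ : Sh α ⊗[ℝ] Sh α →ₗ[ℝ] ℝ)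
    (hφ : ∀ x y, φ (word x ⊗ₜ[ℝ] word y) = K x y) (w : List α) :
    φ (redCoprod (word w)) = deconcSum K w - K [] w - K w [] := by
  have h1 : redCoprod (word w) =
      coprod (word w) - word [] ⊗ₜ[ℝ] word w - word w ⊗ₜ[ℝ] word [] := by
    simp [redCoprod, word]
  have h2 : coprod (word w) =
      ∑ i ∈ Finset.range (w.length + 1), word (w.take i) ⊗ₜ[ℝ] word (w.drop i) := by
    simp [coprod, word]
  rw [h1, map_sub, map_sub, h2, map_sum, hφ, hφ, deconcSum_eq_sum_range]
  simp only [hφ]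

lemma IsPrimitive.coeffFun_pow_nil {P : FreeAssoc α} (hP : IsPrimitive P) {n : ℕ} (hn : n ≠ 0) :
    coeffFun (P ^ n) [] = 0 := by
  obtain ⟨n, rfl⟩ := Nat.exists_eq_succ_of_ne_zero hn
  rw [pow_succ', coeffFun_mul_eq_deconcSum, deconcSum, hP.coeffFun_nil, zero_mul]

lemma IsPrimitive.coeffFun_pow_of_length_lt {P : FreeAssoc α} (hP : IsPrimitive P) {n : ℕ}
    {w : List α} (h : w.length < n) : coeffFun (P ^ n) w = 0 := by
  induction n generalizing w with
  | zero => omega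
  | succ n ih =>
    rw [pow_succ', coeffFun_mul]
    refine Finset.sum_eq_zero fun i hi => ?_
    rcases Nat.eq_zero_or_pos i with rfl | h0
    · simp [hP.coeffFun_nil]
    · rw [Finset.mem_range] at hi
      rw [ih (by rw [List.length_drop]; omega), mul_zero]

/-- Heuristically, `exp (tP)` is group-like, so the adjoint of the operator sends it to `(exp (tP) -
1) ^ (r + 1)`; compare coefficients of `t ^ n`. -/
lemma IsPrimitive.dualPairing_pow_prodRedCoprod {P : FreeAssoc α} (hP : IsPrimitive P)
    (n r : ℕ) {w : List α} (hw : w ≠ []) :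
    dualPairing (P ^ n) (prodRedCoprod (r + 1) (word w)) =
      n.factorial * expSubOneCoeff n (r + 1) * coeffFun (P ^ n) w := by
  induction r generalizing n w with
  | zero =>
    rw [expSubOneCoeff_one, prodRedCoprod, LinearMap.id_apply, dualPairing_word]
    split_ifs with h
    · rw [h, pow_zero, coeffFun_one, counit, if_neg hw, mul_zero]
    · have : (n.factorial : ℝ) ≠ 0 := by positivity
      field_simp
  | succ r ih =>
    let φ : Sh α ⊗[ℝ] Sh α →ₗ[ℝ] ℝ := dualPairing (P ^ n) ∘ₗ TensorProduct.lift shuffleMul ∘ₗ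
      TensorProduct.map LinearMap.id (prodRedCoprod (r + 1))
    have hφ : ∀ x y, φ (word x ⊗ₜ[ℝ] word y) = ∑ p ∈ Finset.HasAntidiagonal.antidiagonal n,
        (n.choose p.1 : ℝ) * (coeffFun (P ^ p.1) x *
          dualPairing (P ^ p.2) (prodRedCoprod (r + 1) (word y))) := by
      intro x y
      simp only [φ, LinearMap.comp_apply, TensorProduct.map_tmul, TensorProduct.lift.tmul,
        LinearMap.id_apply, hP.dualPairing_pow_shuffleMul, dualPairing_word]
    have hstart : dualPairing (P ^ n) (prodRedCoprod (r + 1 + 1) (word w)) =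
        φ (redCoprod (word w)) := rfl
    -- `L` is the inductive formula, available only for nonempty `y`. It vanishes on the boundary
    -- because positive powers of `P` have no constant term and the series coefficients vanish in
    -- degree zero.
    rw [hstart, map_redCoprod_word φ hφ, deconcSum_sub_boundary (L := fun x y =>
      ∑ p ∈ Finset.HasAntidiagonal.antidiagonal n, (n.factorial *
        ((if p.1 = 0 then 0 else (1 : ℝ) / p.1.factorial) * expSubOneCoeff p.2 (r + 1))) *
        (coeffFun (P ^ p.1) x * coeffFun (P ^ p.2) y)) hw]
    · simp only [deconcSum_sum, deconcSum_mul_left, ← coeffFun_mul_eq_deconcSum, ← pow_add]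
      rw [expSubOneCoeff_succ, Finset.mul_sum, Finset.sum_mul]
      refine Finset.sum_congr rfl fun p hp => ?_
      rw [Finset.HasAntidiagonal.mem_antidiagonal.1 hp]
    · intro x y hx hy
      refine Finset.sum_congr rfl fun p hp => ?_
      rw [ih p.2 hy]
      split_ifs with h
      · rw [h, pow_zero, coeffFun_one, counit, if_neg hx]
        ring
      · have h1 : (p.1.factorial : ℝ) ≠ 0 := by positivity
        rw [← Finset.HasAntidiagonal.mem_antidiagonal.1 hp,
          ← Nat.add_choose_mul_factorial_mul_factorial p.1 p.2, Nat.choose_symm_add]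
        push_cast
        field_simp
    · intro y
      refine Finset.sum_eq_zero fun p _ => ?_
      split_ifs with h
      · ring
      · rw [hP.coeffFun_pow_nil h]; ring
    · intro x
      refine Finset.sum_eq_zero fun p _ => ?_
      by_cases h : p.2 = 0
      · rw [h, expSubOneCoeff_of_lt (Nat.succ_pos r)]; ring
      · rw [hP.coeffFun_pow_nil h]; ring

/-- The Eulerian idempotent extracts the linear part of powers of primitive elements. -/
lemma IsPrimitive.dualPairing_pow_eulerian {P : FreeAssoc α} (hP : IsPrimitive P)
    (n : ℕ) {w : List α} (hw : w ≠ []) :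
    dualPairing (P ^ n) (eulerian (word w)) = if n = 1 then coeffFun P w else 0 := by
  have h1 : eulerian (word w) = ∑ r ∈ Finset.Icc 1 w.length,
      ((-1 : ℝ) ^ (r - 1) / (r : ℝ)) • prodRedCoprod r (word w) := by
    simp [eulerian, word]
  have h2 : dualPairing (P ^ n) (eulerian (word w)) =
      (∑ r ∈ Finset.Icc 1 w.length, (-1 : ℝ) ^ (r - 1) / (r : ℝ) * expSubOneCoeff n r) *
        (n.factorial * coeffFun (P ^ n) w) := by
    rw [h1, map_sum, Finset.sum_mul]
    refine Finset.sum_congr rfl fun r hr => ?_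
    obtain ⟨r, rfl⟩ := Nat.exists_eq_succ_of_ne_zero
      (Nat.one_le_iff_ne_zero.1 (Finset.mem_Icc.1 hr).1)
    rw [map_smul, Nat.succ_eq_add_one, hP.dualPairing_pow_prodRedCoprod n r hw, smul_eq_mul]
    ring
  rw [h2]
  rcases Nat.eq_zero_or_pos n with rfl | hn
  · rw [pow_zero, coeffFun_one, counit, if_neg hw]; simp
  -- For `n > w.length` the truncated logarithm says nothing, but `P ^ n` vanishes on `w`.
  · rcases le_or_gt n w.length with hnw | hnw
    · rw [sum_expSubOneCoeff hn.ne' hnw]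
      split_ifs with h
      · simp [h]
      · simp
    · rw [hP.coeffFun_pow_of_length_lt hnw, mul_zero, mul_zero]
      split_ifs with h
      · have := List.length_pos_iff.2 hw
        omega
      · rfl

/-- A power of a primitive element paired with a shuffle product of elements of the
augmentation ideal. -/
lemma IsPrimitive.dualPairing_pow_shuffleProd {P : FreeAssoc α} (hP : IsPrimitive P)
    (l : List (Sh α)) (h0 : ∀ x ∈ l, dualPairing (1 : FreeAssoc α) x = 0) (n : ℕ)
    (h : n ≤ l.length ∨ ∀ x ∈ l, ∀ j, 2 ≤ j → dualPairing (P ^ j) x = 0) :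
    dualPairing (P ^ n) (shuffleProd l) =
      if n = l.length then n.factorial * (l.map (dualPairing P)).prod else 0 := by
  induction l generalizing n with
  | nil =>
    change dualPairing (P ^ n) (word []) = _
    rw [dualPairing_word]
    split_ifs with hn
    · have : n = 0 := hn
      subst this
      simp [coeffFun_one]
    · exact hP.coeffFun_pow_nil hn
  | cons x l ih =>
    have hx0 := h0 x List.mem_cons_self
    have ih' := ih fun y hy => h0 y (List.mem_cons_of_mem x hy)
    change dualPairing (P ^ n) (shuffleMul x (shuffleProd l)) = _
    rw [hP.dualPairing_pow_shuffleMul]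
    cases n with
    | zero => simp [hx0]
    | succ n =>
      -- Exactly one copy of `P` must go to `x`: with none, `x` pairs to zero with `1`; with two or
      -- more, either too few are left for `l`, or `x` itself is killed.
      have hbig : ∀ p ∈ Finset.HasAntidiagonal.antidiagonal (n + 1), p ≠ (1, n) →
          ((n + 1).choose p.1 : ℝ) *
            (dualPairing (P ^ p.1) x * dualPairing (P ^ p.2) (shuffleProd l)) = 0 := by
        rintro ⟨i, j⟩ hp hne
        have hij : i + j = n + 1 := Finset.HasAntidiagonal.mem_antidiagonal.1 hp
        rcases Nat.eq_zero_or_pos i with rfl | hi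
        · simp [hx0]
        · have hi2 : 2 ≤ i := by
            by_contra hlt
            exact hne (Prod.ext (show i = 1 by omega) (show j = n by omega))
          rcases h with h | h
          · rw [List.length_cons] at h
            dsimp only
            rw [ih' j (Or.inl (by omega)), if_neg (by omega), mul_zero, mul_zero]
          · dsimp only
            rw [h x List.mem_cons_self i hi2, zero_mul, mul_zero]
      rw [Finset.sum_eq_single_of_mem (1, n)
        (Finset.HasAntidiagonal.mem_antidiagonal.2 (Nat.add_comm 1 n)) hbig]
      dsimp only
      rw [pow_one, ih' n (h.imp (fun h => by simpa using h)
        fun h y hy => h y (List.mem_cons_of_mem x hy))]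
      simp only [List.length_cons, Nat.add_right_cancel_iff, List.map_cons, List.prod_cons]
      split_ifs
      · rw [Nat.choose_one_right, Nat.factorial_succ]
        push_cast
        ring
      · simp

end Eulerian

/-! ### Polarization of symmetrized products -/

section Polarization

/-- The polarization formula for the symmetrization of a multilinear form. -/
lemma sum_perm_eq_sum_diagonal {M : Type*} [AddCommGroup M] [Module ℝ M] {k : ℕ}
    (f : MultilinearMap ℝ (fun _ : Fin k => M) ℝ) (p : Fin k → M) :
    ∑ σ : Equiv.Perm (Fin k), f (fun i => p (σ i)) =
      ∑ T : Finset (Fin k), (-1 : ℝ) ^ T.card * f (fun _ => ∑ i ∈ Tᶜ, p i) := by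
  classical
  have h1 : ∀ T : Finset (Fin k), (-1 : ℝ) ^ T.card * f (fun _ => ∑ i ∈ Tᶜ, p i) =
      ∑ r : Fin k → Fin k, if T ⊆ (Finset.univ.image r)ᶜ then
        (-1 : ℝ) ^ T.card * f (fun i => p (r i)) else 0 := by
    intro T
    rw [MultilinearMap.map_sum_finset f (fun _ => p) (fun _ => Tᶜ), Finset.mul_sum,
      ← Finset.sum_filter]
    refine Finset.sum_congr ?_ fun _ _ => rfl
    ext r
    simp only [Fintype.mem_piFinset, Finset.mem_compl, Finset.mem_filter, Finset.mem_univ,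
      true_and, Finset.subset_iff, Finset.mem_image, not_exists]
    exact ⟨fun h x hx i hi => h i (hi ▸ hx), fun h i hi => h hi i rfl⟩
  -- Inclusion-exclusion: the signed sum over subsets of the complement of the image vanishes unless
  -- `r` is surjective, that is, a permutation.
  have h2 : ∀ r : Fin k → Fin k, (∑ T : Finset (Fin k), if T ⊆ (Finset.univ.image r)ᶜ then
        (-1 : ℝ) ^ T.card * f (fun i => p (r i)) else 0) =
      if Function.Surjective r then f (fun i => p (r i)) else 0 := by
    intro r
    rw [← Finset.sum_filter, ← Finset.sum_mul]
    have h3 : Finset.univ.filter (fun T => T ⊆ (Finset.univ.image r)ᶜ) =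
        (Finset.univ.image r)ᶜ.powerset := by
      ext T; simp
    have h4 := congrArg (Int.cast (R := ℝ))
      (Finset.sum_powerset_neg_one_pow_card (x := (Finset.univ.image r)ᶜ))
    push_cast at h4
    rw [h3, h4]
    have h5 : (Finset.univ.image r)ᶜ = ∅ ↔ Function.Surjective r := by
      simp [Finset.eq_univ_iff_forall, Function.Surjective]
    simp only [h5]
    split_ifs <;> simp
  rw [Finset.sum_congr rfl fun T _ => h1 T, Finset.sum_comm, Finset.sum_congr rfl fun r _ => h2 r,
    ← Finset.sum_filter]
  refine Finset.sum_bij (fun σ _ => (σ : Fin k → Fin k)) (fun σ _ => ?_) (fun σ _ τ _ h => ?_)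
    (fun r hr => ?_) fun _ _ => rfl
  · simpa using σ.surjective
  · exact DFunLike.coe_injective h
  · have hr' : Function.Surjective r := by simpa using hr
    exact ⟨Equiv.ofBijective r (Finite.injective_iff_surjective.2 hr' |> fun h => ⟨h, hr'⟩),
      Finset.mem_univ _, rfl⟩

variable {α : Type*}

/-- The pairing with a fixed element of the shuffle algebra. -/
def dualPairingRight (x : Sh α) : FreeAssoc α →ₗ[ℝ] ℝ where
  toFun P := dualPairing P x
  map_add' P Q := by
    simp only [dualPairing, linExt, Finsupp.linearCombination_apply, Finsupp.sum, smul_eq_mul,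
      ← Finset.sum_add_distrib, ← mul_add]
    rfl
  map_smul' c P := by
    simp only [dualPairing, linExt, Finsupp.linearCombination_apply, Finsupp.sum, smul_eq_mul,
      RingHom.id_apply, Finset.mul_sum]
    refine Finset.sum_congr rfl fun v _ => ?_
    change x v * (c * coeffFun P v) = _
    ring

lemma sum_dualPairing_prod_eq_zero {k : ℕ} {p : Fin k → FreeAssoc α}
    (hp : ∀ i, IsPrimitive (p i)) {g : Sh α}
    (hg : ∀ P : FreeAssoc α, IsPrimitive P → dualPairing (P ^ k) g = 0) :
    ∑ σ : Equiv.Perm (Fin k), dualPairing (List.ofFn fun i => p (σ i)).prod g = 0 := by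
  have h := sum_perm_eq_sum_diagonal ((dualPairingRight g).compMultilinearMap
    (MultilinearMap.mkPiAlgebraFin ℝ k (FreeAssoc α))) p
  simp only [LinearMap.compMultilinearMap_apply, MultilinearMap.mkPiAlgebraFin_apply,
    List.ofFn_const, List.prod_replicate] at h
  refine h.trans (Finset.sum_eq_zero fun T _ => ?_)
  change _ * dualPairing _ g = 0
  rw [hg _ (IsPrimitive.sum _ hp), mul_zero]

/-- Both sides are symmetrized multilinear forms in `p`. Polarizing each reduces the identity to
diagonal values at subset sums of the `p i`, which are primitive. -/
lemma sum_dualPairing_prod {k : ℕ} {p : Fin k → FreeAssoc α} (hp : ∀ i, IsPrimitive (p i))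
    {g : Sh α} (x : Fin k → Sh α) (hg : ∀ P : FreeAssoc α, IsPrimitive P →
      dualPairing (P ^ k) g = k.factorial * ∏ i, dualPairing P (x i)) :
    ∑ σ : Equiv.Perm (Fin k), dualPairing (List.ofFn fun i => p (σ i)).prod g =
      k.factorial * ∑ σ : Equiv.Perm (Fin k), ∏ i, dualPairing (p (σ i)) (x i) := by
  have h := sum_perm_eq_sum_diagonal ((dualPairingRight g).compMultilinearMap
    (MultilinearMap.mkPiAlgebraFin ℝ k (FreeAssoc α))) p
  have h' := sum_perm_eq_sum_diagonal (((k.factorial : ℝ) •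
    MultilinearMap.mkPiAlgebra ℝ (Fin k) ℝ).compLinearMap fun i => dualPairingRight (x i)) p
  simp only [LinearMap.compMultilinearMap_apply, MultilinearMap.mkPiAlgebraFin_apply,
    List.ofFn_const, List.prod_replicate] at h
  simp only [MultilinearMap.compLinearMap_apply, smul_apply,
    MultilinearMap.mkPiAlgebra_apply, smul_eq_mul, ← Finset.mul_sum] at h'
  refine h.trans (Eq.trans (Finset.sum_congr rfl fun T _ => ?_) h'.symm)
  congr 1
  exact hg _ (IsPrimitive.sum _ hp)

end Polarization


/-! ### Evaluation of the pairing -/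

section Duality

variable {α : Type*} [LinearOrder α]

lemma stabCard_pos (w : List α) : 0 < stabCard w := by
  unfold stabCard
  have : Nonempty {σ : Equiv.Perm (Fin (numFactors w)) // ∀ i, factor w (σ i) = factor w i} :=
    ⟨⟨1, fun _ => rfl⟩⟩
  exact Nat.card_pos

lemma rightVec_eq_smul_sum (w : List α) :
    rightVec w = (1 / ((stabCard w : ℝ) * ((numFactors w).factorial : ℝ))) •
      ∑ σ : Equiv.Perm (Fin (numFactors w)),
        (List.ofFn fun i => stdBracket (factor w (σ i))).prod := by
  rw [rightVec]
  split_ifs with h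
  -- The index type depends on the factor list, so the list is generalised before being replaced by
  -- `[w]`; all normalising constants are then 1.
  · have key : ∀ l : List (List α), l = [w] →
        stdBracket w = (1 / ((Nat.card {σ : Equiv.Perm (Fin l.length) //
          ∀ i, l.get (σ i) = l.get i} : ℝ) * (l.length.factorial : ℝ))) •
        ∑ σ : Equiv.Perm (Fin l.length),
          (List.ofFn fun i => stdBracket (l.get (σ i))).prod := by
      rintro _ rfl
      simp
    exact key _ (lyndonFactors_of_isLyndon h)
  · rfl

lemma rightEfn_of_isLyndon {u : List α} (hu : IsLyndon u) :
    rightEfn u = coeffFun (stdBracket u) := by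
  funext v
  rw [rightEfn, rightVec, if_pos hu]

lemma pairing_eq_dualPairing (w w' : List α) :
    pairing (rightEfn w') (leftEfn w) = dualPairing (rightVec w') (leftVec w) := by
  rw [pairing, finsum_eq_sum_of_support_subset (s := (leftVec w).support)]
  · simp only [dualPairing, linExt, Finsupp.linearCombination_apply, Finsupp.sum, smul_eq_mul]
    exact Finset.sum_congr rfl fun v _ => mul_comm _ _
  · intro v hv
    exact Finsupp.mem_support_iff.2 (right_ne_zero_of_mul hv)

lemma dualPairing_rightVec (w : List α) (g : Sh α) :
    dualPairing (rightVec w) g = 1 / ((stabCard w : ℝ) * ((numFactors w).factorial : ℝ)) *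
      ∑ σ : Equiv.Perm (Fin (numFactors w)),
        dualPairing (List.ofFn fun i => stdBracket (factor w (σ i))).prod g := by
  have h := congrArg (dualPairingRight g) (rightVec_eq_smul_sum w)
  rw [map_smul, map_sum, smul_eq_mul] at h
  exact h

lemma prod_map_lyndonFactors (w : List α) (f : List α → ℝ) :
    ((lyndonFactors w).map f).prod = ∏ i, f (factor w i) :=
  (Fin.prod_univ_fun_getElem (lyndonFactors w) f).symm

lemma IsPrimitive.dualPairing_pow_leftVec {P : FreeAssoc α} (hP : IsPrimitive P) (w : List α)
    (n : ℕ) : dualPairing (P ^ n) (leftVec w) =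
      if n = numFactors w then n.factorial * ∏ i, coeffFun P (factor w i) else 0 := by
  have hne : ∀ u ∈ lyndonFactors w, u ≠ [] := fun u hu => (isLyndon_of_mem_lyndonFactors hu).1
  have hmap : ((lyndonFactors w).map fun u => eulerian (word u)).map (dualPairing P) =
      (lyndonFactors w).map (coeffFun P) := by
    rw [List.map_map]
    refine List.map_congr_left fun u hu => ?_
    have := hP.dualPairing_pow_eulerian 1 (hne u hu)
    rwa [pow_one, if_pos rfl] at this
  rw [leftVec, hP.dualPairing_pow_shuffleProd, List.length_map, hmap, prod_map_lyndonFactors]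
  · rfl
  · intro x hx
    obtain ⟨u, hu, rfl⟩ := List.mem_map.1 hx
    have := hP.dualPairing_pow_eulerian 0 (hne u hu)
    rwa [pow_zero, if_neg zero_ne_one] at this
  · refine Or.inr fun x hx j hj => ?_
    obtain ⟨u, hu, rfl⟩ := List.mem_map.1 hx
    rw [hP.dualPairing_pow_eulerian j (hne u hu), if_neg (by omega)]

/-- Higher powers of `P` need not kill a factor `word u`, but with exactly as many copies of `P` as
factors, each nonempty factor must receive one. -/
lemma IsPrimitive.dualPairing_pow_shuffleProd_factors {P : FreeAssoc α} (hP : IsPrimitive P)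
    (w : List α) : dualPairing (P ^ numFactors w) (shuffleProd ((lyndonFactors w).map word)) =
      (numFactors w).factorial * ∏ i, coeffFun P (factor w i) := by
  have hmap : ((lyndonFactors w).map word).map (dualPairing P) =
      (lyndonFactors w).map (coeffFun P) := by
    rw [List.map_map]
    exact List.map_congr_left fun u _ => dualPairing_word P u
  rw [hP.dualPairing_pow_shuffleProd, List.length_map, hmap, prod_map_lyndonFactors]
  · exact if_pos rfl
  · intro x hx
    obtain ⟨u, hu, rfl⟩ := List.mem_map.1 hx
    rw [dualPairing_word, coeffFun_one, counit, if_neg (isLyndon_of_mem_lyndonFactors hu).1]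
  · exact Or.inl (by rw [List.length_map]; rfl)

lemma isPrimitive_stdBracket_factor (w : List α) (i : Fin (numFactors w)) :
    IsPrimitive (stdBracket (factor w i)) :=
  isPrimitive_stdBracket _ (isLyndon_factor w i).1

lemma pairing_eq_zero_of_numFactors_ne {w w' : List α} (h : numFactors w ≠ numFactors w') :
    pairing (rightEfn w') (leftEfn w) = 0 := by
  rw [pairing_eq_dualPairing, dualPairing_rightVec,
    sum_dualPairing_prod_eq_zero (isPrimitive_stdBracket_factor w'), mul_zero]
  intro P hP
  rw [hP.dualPairing_pow_leftVec, if_neg h.symm]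

lemma sum_perm_cast {k k' : ℕ} (h : k = k') {A : Type*} (G : Fin k' → A)
    (φ : List A → ℝ) : ∑ σ : Equiv.Perm (Fin k'), φ (List.ofFn fun i => G (σ i)) =
      ∑ σ : Equiv.Perm (Fin k), φ (List.ofFn fun i => G (Fin.cast h (σ i))) := by
  subst h
  rfl

/-- The pairing of `f_{w'}` with any element on which powers of primitive elements take the
expected values. -/
lemma dualPairing_rightVec_eq {w w' : List α} (h : numFactors w = numFactors w') {g : Sh α}
    (hg : ∀ P : FreeAssoc α, IsPrimitive P → dualPairing (P ^ numFactors w) g =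
      (numFactors w).factorial * ∏ i, coeffFun P (factor w i)) :
    dualPairing (rightVec w') g =
      1 / (stabCard w' : ℝ) * ∑ σ : Equiv.Perm (Fin (numFactors w)),
        ∏ i, rightEfn (factor w' (Fin.cast h (σ i))) (factor w i) := by
  have hsum := sum_dualPairing_prod
    (p := fun i : Fin (numFactors w) => stdBracket (factor w' (Fin.cast h i)))
    (fun i => isPrimitive_stdBracket_factor w' _) (fun i => word (factor w i))
    (fun P hP => by simpa using hg P hP)
  rw [dualPairing_rightVec, sum_perm_cast h (fun i => stdBracket (factor w' i))
    (fun l => dualPairing l.prod g), hsum,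
    show (numFactors w').factorial = (numFactors w).factorial from congrArg _ h.symm]
  simp only [dualPairing_word, rightEfn_of_isLyndon (isLyndon_factor w' _)]
  have h1 : ((numFactors w).factorial : ℝ) ≠ 0 := by positivity
  have h2 : (stabCard w' : ℝ) ≠ 0 := by exact_mod_cast (stabCard_pos w').ne'
  field_simp

lemma pairing_eq_sum {w w' : List α} (h : numFactors w = numFactors w') :
    pairing (rightEfn w') (leftEfn w) =
      1 / (stabCard w' : ℝ) * ∑ σ : Equiv.Perm (Fin (numFactors w)),
        ∏ i, rightEfn (factor w' (Fin.cast h (σ i))) (factor w i) := by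
  rw [pairing_eq_dualPairing]
  exact dualPairing_rightVec_eq h fun P hP => by rw [hP.dualPairing_pow_leftVec, if_pos rfl]

/-- Following the cycle of `σ` from `σ i` back to `i` gives the reverse inequality. -/
lemma eq_of_perm_le {ι β : Type*} [Finite ι] [PartialOrder β] {f : ι → β} {σ : Equiv.Perm ι}
    (h : ∀ i, f (σ i) ≤ f i) (i : ι) : f (σ i) = f i := by
  have hpow : ∀ (n : ℕ) (j : ι), f ((σ ^ n) j) ≤ f j := by
    intro n
    induction n with
    | zero => intro j; simp
    | succ n ih => intro j; rw [pow_succ']; exact (h _).trans (ih j)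
  obtain ⟨n, hn, hσ⟩ := (isOfFinOrder_of_finite σ).exists_pow_eq_one
  obtain ⟨m, rfl⟩ := Nat.exists_eq_succ_of_ne_zero hn.ne'
  have := hpow m (σ i)
  rw [← Equiv.Perm.mul_apply, ← pow_succ, hσ, Equiv.Perm.one_apply] at this
  exact le_antisymm (h i) this

lemma deg_eq_and_le_of_rightEfn_ne_zero {u v : List α} (hu : IsLyndon u)
    (h : rightEfn u v ≠ 0) : deg u = deg v ∧ u ≤ v := by
  rw [rightEfn_of_isLyndon hu] at h
  obtain ⟨h1, h2⟩ := (supportedAbove_stdBracket u hu).1 v h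
  exact ⟨funext fun a => (h1.count_eq a).symm, h2⟩

lemma pairing_self (w : List α) : pairing (rightEfn w) (leftEfn w) = 1 := by
  classical
  -- A nonzero term forces `factor w (σ i) ≤ factor w i` throughout, hence equality; the
  -- permutations left are those counted by `stabCard w`.
  have hterm : ∀ σ : Equiv.Perm (Fin (numFactors w)),
      ∏ i, rightEfn (factor w (Fin.cast rfl (σ i))) (factor w i) =
        if ∀ i, factor w (σ i) = factor w i then 1 else 0 := by
    intro σ
    split_ifs with h
    · refine Finset.prod_eq_one fun i _ => ?_
      rw [Fin.cast_eq_self, h, rightEfn_of_isLyndon (isLyndon_factor w i)]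
      exact (supportedAbove_stdBracket _ (isLyndon_factor w i)).2
    · by_contra hne
      refine h (eq_of_perm_le fun i => ?_)
      exact (deg_eq_and_le_of_rightEfn_ne_zero (isLyndon_factor w _)
        (Finset.prod_ne_zero_iff.1 hne i (Finset.mem_univ i))).2
  rw [pairing_eq_sum rfl, Finset.sum_congr rfl fun σ _ => hterm σ, Finset.sum_boole]
  have hcard : stabCard w =
      (Finset.univ.filter fun σ : Equiv.Perm (Fin (numFactors w)) =>
        ∀ i, factor w (σ i) = factor w i).card := by
    rw [stabCard, Nat.card_eq_fintype_card, Fintype.card_subtype]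
  rw [← hcard]
  exact one_div_mul_cancel (by exact_mod_cast (stabCard_pos w).ne')

end Duality

end RiffleShuffle

end

open RiffleShuffle in
theorem theorem6p1p5 {α : Type*} [LinearOrder α] (w w' : List α) :
    (numFactors w ≠ numFactors w' → pairing (rightEfn w') (leftEfn w) = 0) ∧
    (∀ h : numFactors w = numFactors w',
      pairing (rightEfn w') (leftEfn w) =
        1 / (stabCard w' : ℝ) * ∑ σ : Equiv.Perm (Fin (numFactors w)),
          ∏ i, rightEfn (factor w' (Fin.cast h (σ i))) (factor w i) ∧
      pairing (rightEfn w') (leftEfn w) =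
        linExt (rightEfn w') (shuffleProd ((lyndonFactors w).map word))) ∧
    pairing (rightEfn w) (leftEfn w) = 1 ∧
    (pairing (rightEfn w') (leftEfn w) ≠ 0 →
      ∃ h : numFactors w = numFactors w', ∃ σ : Equiv.Perm (Fin (numFactors w)),
        ∀ i, deg (factor w' (Fin.cast h (σ i))) = deg (factor w i) ∧
          factor w' (Fin.cast h (σ i)) ≤ factor w i) := by
  refine ⟨pairing_eq_zero_of_numFactors_ne, fun h => ⟨pairing_eq_sum h, ?_⟩, pairing_self w,
    fun hne => ?_⟩
  · rw [pairing_eq_sum h]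
    -- The shuffle product of the factors agrees with `leftVec w` on `k`-th powers of primitives,
    -- which is all that `rightVec w'` sees.
    exact (dualPairing_rightVec_eq h fun P hP => hP.dualPairing_pow_shuffleProd_factors w).symm
  · have h : numFactors w = numFactors w' := by
      by_contra h
      exact hne (pairing_eq_zero_of_numFactors_ne h)
    rw [pairing_eq_sum h] at hne
    obtain ⟨σ, -, hσ⟩ := Finset.exists_ne_zero_of_sum_ne_zero (right_ne_zero_of_mul hne)
    exact ⟨h, σ, fun i => deg_eq_and_le_of_rightEfn_ne_zero (isLyndon_factor w' _)
      (Finset.prod_ne_zero_iff.1 hσ i (Finset.mem_univ i))⟩
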